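/- Let $V_0,V_1$ be disjoint finite sets and $r_0,r_1\ge 0$ integers, not both zero. An $(r_0,r_1)$-bounded hypergraph $\mathcal H$ on $V_0\cup V_1$ is a set of edges $E(\mathcal H)\subset \binom{V_0}{\le r_0}\times\binom{V_1}{\le r_1}$, where $\binom{V}{\le k}$ denotes the family of subsets of $V$ with at most $k$ elements; write $e(\mathcal H)=|E(\mathcal H)|$. A pair $(W_0,W_1)\in 2^{V_0}\times 2^{V_1}$ is independent if there is no $(e_0,e_1)\in E(\mathcal H)$ with $e_0\subset V_0\setminus W_0$ and $e_1\subset W_1$. Let $\mathcal F_{\le m}(\mathcal H)$ be the family of independent pairs $(W_0,W_1)$ with $|W_0|\le m$. Let $\Delta_{(\ell_0,\ell_1)}(\mathcal H)$ be the maximum, over all $L_0\subset V_0$, $L_1\subset V_1$ with $|L_0|=\ell_0$, $|L_1|=\ell_1$, of the number of edges $(e_0,e_1)$ with $L_0\subset e_0$ and $L_1\subset e_1$ (and $0$ if there are no such $L_0,L_1$). **Theorem.** Let $r_0,r_1$ be non-negative integers, not both zero, and let $R>0$ be real. Let $\mathcal H$ be an $(r_0,r_1)$-bounded hypergraph on $V_0\cup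 V_1$ with at least one edge, and let $b,m,q$ be positive integers with $b\le\min\{m,|V_1|\}$ such that $$\Delta_{(\ell_0,\ell_1)}(\mathcal H)\le R\,\frac{b^{\ell_0+\ell_1-1}}{m^{\ell_0}|V_1|^{\ell_1}}\,e(\mathcal H)\left(\frac mq\right)^{\mathbf 1[\ell_0>0]}$$ for every $(\ell_0,\ell_1)\in\{0,\dots,r_0\}\times\{0,\dots,r_1\}\setminus\{(0,0)\}$. Put $\delta=2^{-(r_0+r_1+1)(r_0+r_1)}R^{-1}$. Then there exist a family $\mathcal S\subset\binom{V_0}{\le r_0b}\times\binom{V_1}{\le r_1b}$ and functions $f:\mathcal S\to 2^{V_0}\times 2^{V_1}$ and $g:\mathcal F_{\le m}(\mathcal H)\to\mathcal S$ such that: (i) for every $(I,J)\in\mathcal F_{\le m}(\mathcal H)$, if $f(g(I,J))=(A,B)$, then $A\subset I$ and $J\subset B$; (ii) for every $(A,B)\in f(\mathcal S)$, either $|A|\ge\delta q$ or $|B|\le(1-\delta)|V_1|$; (iii) for every $(I,J)\in\mathcal F_{\le m}(\mathcal H)$, if $g(I,J)=(S_0,S_1)$ and $f(g(I,J))=(A,B)$,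 then $S_0\subset V_0\setminus I$ and $S_1\subset J$, and $|S_0|>0$ only if $|A|\ge\delta q$. -/

import Mathlib

/-- An `(r₀, r₁)`-bounded hypergraph on the disjoint union of the finite vertex sets `V₀` and `V₁`:
a set of edges `(e₀, e₁)` with `e₀ ⊆ V₀`, `|e₀| ≤ r₀`, `e₁ ⊆ V₁`, `|e₁| ≤ r₁`. -/
structure BoundedHypergraph (V₀ V₁ : Type*) (r₀ r₁ : ℕ) where
  /-- The set of edges. -/
  edges : Finset (Finset V₀ × Finset V₁)
  card_le : ∀ e ∈ edges, e.1.card ≤ r₀ ∧ e.2.card ≤ r₁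

namespace BoundedHypergraph

/-- The pair `W = (W₀, W₁)` violates the edge `e = (e₀, e₁)` if `e₀ ⊆ V₀ ∖ W₀` and `e₁ ⊆ W₁`. -/
def Violates {V₀ V₁ : Type*} [Fintype V₀] [DecidableEq V₀]
    (W e : Finset V₀ × Finset V₁) : Prop :=
  e.1 ⊆ W.1ᶜ ∧ e.2 ⊆ W.2

/-- A pair is independent if it violates no edge. -/
def Independent {V₀ V₁ : Type*} [Fintype V₀] [DecidableEq V₀] {r₀ r₁ : ℕ}
    (H : BoundedHypergraph V₀ V₁ r₀ r₁) (W : Finset V₀ × Finset V₁) : Prop :=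
  ∀ e ∈ H.edges, ¬ Violates W e

/-- The family of independent pairs `(W₀, W₁)` with `|W₀| ≤ m`. -/
def indepPairs {V₀ V₁ : Type*} [Fintype V₀] [DecidableEq V₀] {r₀ r₁ : ℕ}
    (H : BoundedHypergraph V₀ V₁ r₀ r₁) (m : ℕ) : Set (Finset V₀ × Finset V₁) :=
  {W | H.Independent W ∧ W.1.card ≤ m}

/-- The codegree of `(L₀, L₁)`: the number of edges `(e₀, e₁)` with `L₀ ⊆ e₀` and `L₁ ⊆ e₁`. -/
def codegree {V₀ V₁ : Type*} [DecidableEq V₀] [DecidableEq V₁] {r₀ r₁ : ℕ}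
    (H : BoundedHypergraph V₀ V₁ r₀ r₁) (L₀ : Finset V₀) (L₁ : Finset V₁) : ℕ :=
  (H.edges.filter fun e => L₀ ⊆ e.1 ∧ L₁ ⊆ e.2).card

/-- The maximum `(ℓ₀, ℓ₁)`-codegree: the maximum of the codegrees of all pairs `(L₀, L₁)` with
`|L₀| = ℓ₀` and `|L₁| = ℓ₁` (it is `0` if there are no such pairs). -/
def maxCodegree {V₀ V₁ : Type*} [Fintype V₀] [Fintype V₁] [DecidableEq V₀] [DecidableEq V₁]
    {r₀ r₁ : ℕ} (H : BoundedHypergraph V₀ V₁ r₀ r₁) (ℓ₀ ℓ₁ : ℕ) : ℕ :=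
  (Finset.powersetCard ℓ₀ (Finset.univ : Finset V₀) ×ˢ
    Finset.powersetCard ℓ₁ (Finset.univ : Finset V₁)).sup fun L => H.codegree L.1 L.2

end BoundedHypergraph

/-- The constant `δ = 2^{-(r₀+r₁+1)(r₀+r₁)} R⁻¹`. -/
noncomputable def containerDelta (r₀ r₁ : ℕ) (R : ℝ) : ℝ :=
  ((2 : ℝ) ^ ((r₀ + r₁ + 1) * (r₀ + r₁)))⁻¹ * R⁻¹

/-! Identify `(I, J)` with `K = (V₀ ∖ I) ⊔ J` in `V₀ ⊕ V₁`; independence says that `K` contains no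
edge. A decision tree asks which vertices lie in `K`. The picked vertices form the fingerprint; the
rejected ones give `A` and the complement of `B`. Run on its picked set, the tree retraces the
branch of `K` (`eq_of_picked_subset`), so the container depends on the fingerprint alone.

In one round (`exists_tree_of_state`), vertices of large degree are queried, and each picked vertex
contributes its link to a hypergraph `G`, no edge of which may lie in `K`. Edges containing a set
whose `G`-degree is already large are discarded, so `G` inherits codegree bounds. Either the
rejected vertices carry half of the weight, hence are numerous, or at most `b` picks make `G` heavy
enough for a round of uniformity one less. Uniformity zero is impossible, as `∅ ⊆ K`, so some round
ends with many rejections.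

Vertices of `V₁` are treated first (`exists_tree`), those of `V₀` afterwards (`exists_tree_left`).
The factor `m / q` enters the bounds only once, so deleting a left vertex costs exactly `b / m` only
if a left vertex remains. This order also yields (iii): left vertices are picked only when the sole
possible ending is at least `δ q` left rejections. `exists_popular_type` supplies the initial
uniform hypergraph. -/

/-! ### Query trees -/

/-- A decision tree that queries membership of vertices in an unknown set. -/
inductive QueryTree (V : Type*) where
  | leaf : QueryTree V
  | query (v : V) (yes no : QueryTree V) : QueryTree V

namespace QueryTree

variable {V : Type*} [DecidableEq V]

/-- The queried vertices on the branch followed by `K` that belong to `K`. -/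
def picked : QueryTree V → Finset V → Finset V
  | leaf, _ => ∅
  | query v yes no, K => if v ∈ K then insert v (yes.picked K) else no.picked K

/-- The queried vertices on the branch followed by `K` that do not belong to `K`. -/
def rejected : QueryTree V → Finset V → Finset V
  | leaf, _ => ∅
  | query v yes no, K => if v ∈ K then yes.rejected K else insert v (no.rejected K)

theorem picked_subset (t : QueryTree V) (K : Finset V) : t.picked K ⊆ K := by
  induction t with
  | leaf => simp [picked]
  | query v yes no hy hn =>
    by_cases h : v ∈ K
    · simpa [picked, h, Finset.insert_subset_iff] using hy
    · simpa [picked, h] using hn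

theorem disjoint_rejected (t : QueryTree V) (K : Finset V) : Disjoint (t.rejected K) K := by
  induction t with
  | leaf => simp [rejected]
  | query v yes no hy hn =>
    by_cases h : v ∈ K
    · simpa [rejected, h] using hy
    · simpa [rejected, h] using hn

/-- The branch followed by `K` is also followed by every set between the picked vertices and `K`. -/
theorem eq_of_picked_subset (t : QueryTree V) {K K' : Finset V} (h : t.picked K ⊆ K')
    (h' : K' ⊆ K) : t.picked K' = t.picked K ∧ t.rejected K' = t.rejected K := by
  induction t with
  | leaf => simp [picked, rejected]
  | query v yes no hy hn =>
    by_cases hv : v ∈ K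
    · simp only [picked, hv, if_true, Finset.insert_subset_iff] at h
      simp [picked, rejected, hv, h.1, hy h.2]
    · simp only [picked, hv, if_false] at h
      have hv' : v ∉ K' := fun hc => hv (h' hc)
      simp [picked, rejected, hv, hv', hn h]

end QueryTree

/-! ### Weighted hypergraphs: degrees, links and saturation -/

namespace WeightedHypergraph

open Finset

variable {V : Type*}

section

variable [Fintype V]

/-- The total weight of a weighted hypergraph. -/
def total (w : Finset V → ℝ) : ℝ := ∑ e, w e

theorem total_add (w w' : Finset V → ℝ) : total (w + w') = total w + total w' := by
  simp [total, sum_add_distrib]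

theorem total_nonneg {w : Finset V → ℝ} (h : 0 ≤ w) : 0 ≤ total w :=
  sum_nonneg fun e _ => h e

end

variable [DecidableEq V]

/-- The weighted link of a vertex. -/
def link (v : V) (w : Finset V → ℝ) (e : Finset V) : ℝ := if v ∈ e then 0 else w (insert v e)

theorem link_nonneg {w : Finset V → ℝ} (hw : 0 ≤ w) (v : V) : 0 ≤ link v w := by
  intro e
  unfold link
  split_ifs
  exacts [le_rfl, hw (insert v e)]

variable [Fintype V]

/-- The weighted degree of a set of vertices. -/
def deg (w : Finset V → ℝ) (T : Finset V) : ℝ := ∑ e with T ⊆ e, w e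

theorem deg_add (w w' : Finset V → ℝ) (T : Finset V) : deg (w + w') T = deg w T + deg w' T := by
  simp [deg, sum_add_distrib]

theorem deg_mono {w w' : Finset V → ℝ} (h : w ≤ w') (T : Finset V) : deg w T ≤ deg w' T :=
  sum_le_sum fun e _ => h e

theorem deg_nonneg {w : Finset V → ℝ} (h : 0 ≤ w) (T : Finset V) : 0 ≤ deg w T :=
  sum_nonneg fun e _ => h e

theorem deg_link_of_mem {v : V} {T : Finset V} (w : Finset V → ℝ) (hv : v ∈ T) :
    deg (link v w) T = 0 := by
  refine sum_eq_zero fun e he => ?_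
  simp [link, (mem_filter.1 he).2 hv]

theorem deg_link_of_notMem {v : V} {T : Finset V} (w : Finset V → ℝ) (hv : v ∉ T) :
    deg (link v w) T = deg w (insert v T) := by
  have h1 : deg (link v w) T = ∑ e with T ⊆ e ∧ v ∉ e, w (insert v e) := by
    rw [deg, ← filter_filter, sum_filter (fun e => v ∉ e)]
    exact sum_congr rfl fun e _ => by by_cases h : v ∈ e <;> simp [link, h]
  rw [h1, deg]
  refine sum_bij' (fun e _ => insert v e) (fun e _ => e.erase v) ?_ ?_ ?_ ?_ ?_
  · intro e he
    simp only [mem_filter, mem_univ, true_and] at he ⊢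
    exact insert_subset_insert v he.1
  · intro e he
    simp only [mem_filter, mem_univ, true_and, insert_subset_iff] at he ⊢
    exact ⟨fun x hx => mem_erase.2 ⟨fun h => hv (h ▸ hx), he.2 hx⟩, notMem_erase v e⟩
  · intro e he
    exact erase_insert (mem_filter.1 he).2.2
  · intro e he
    exact insert_erase ((mem_filter.1 he).2 (mem_insert_self v T))
  · intro e _
    rfl

theorem deg_empty (w : Finset V → ℝ) : deg w ∅ = total w := by
  simp [deg, total]

theorem total_link (v : V) (w : Finset V → ℝ) : total (link v w) = deg w {v} := by
  rw [← deg_empty, deg_link_of_notMem w (notMem_empty v)]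
  rfl

/-- Summing degrees over the nonempty sets counts each edge once per nonempty subset. -/
theorem sum_deg_nonempty {w : Finset V → ℝ} {s : ℕ} (hs : ∀ e, w e ≠ 0 → e.card = s) :
    ∑ T : Finset V with T.Nonempty, deg w T = (2 ^ s - 1) * total w := by
  have h1 : ∀ T, deg w T = ∑ e, if T ⊆ e then w e else 0 := fun T => by rw [deg, sum_filter]
  simp only [h1]
  rw [sum_comm, total, mul_sum]
  refine sum_congr rfl fun e _ => ?_
  rw [← sum_filter, sum_const, nsmul_eq_mul]
  by_cases he : w e = 0
  · simp [he]
  have : (filter (fun T => T ⊆ e) (filter Finset.Nonempty univ)) = e.powerset.erase ∅ := by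
    ext T
    simp [nonempty_iff_ne_empty]
  rw [this, card_erase_of_mem (empty_mem_powerset e), card_powerset, hs e he,
    Nat.cast_sub Nat.one_le_two_pow]
  simp

/-- Among the vertices of a hitting set some vertex has at least average degree. -/
theorem exists_le_deg {w : Finset V → ℝ} (hw : 0 ≤ w) {U : Finset V} {N : ℝ} (hN : 0 < N)
    (hUN : (U.card : ℝ) ≤ N) (hU : ∀ e, w e ≠ 0 → ∃ v ∈ U, v ∈ e) (hpos : 0 < total w) :
    ∃ v ∈ U, total w / N ≤ deg w {v} := by
  by_contra! hcon
  have h1 : total w ≤ ∑ v ∈ U, deg w {v} := by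
    simp only [deg, sum_filter, total]
    rw [sum_comm]
    refine sum_le_sum fun e _ => ?_
    by_cases he : w e = 0
    · simp [he]
    obtain ⟨v, hvU, hve⟩ := hU e he
    calc w e = if {v} ⊆ e then w e else 0 := by simp [hve]
      _ ≤ _ := single_le_sum (f := fun v => if {v} ⊆ e then w e else 0)
        (fun u _ => by split_ifs; exacts [hw e, le_rfl]) hvU
  have hne : U.Nonempty := by
    rw [nonempty_iff_ne_empty]
    rintro rfl
    simp at h1
    linarith
  have h2 : ∑ v ∈ U, deg w {v} < ∑ v ∈ U, total w / N := sum_lt_sum_of_nonempty hne hcon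
  rw [sum_const, nsmul_eq_mul] at h2
  have h3 : (U.card : ℝ) * (total w / N) ≤ N * (total w / N) :=
    mul_le_mul_of_nonneg_right hUN (by positivity)
  rw [mul_div_cancel₀ _ hN.ne'] at h3
  linarith

/-- An edge is saturated if it contains a nonempty set whose degree in `G` reaches the
threshold `θ`. -/
def Saturated (θ : Finset V → ℝ) (G : Finset V → ℝ) (e : Finset V) : Prop :=
  ∃ T, T.Nonempty ∧ T ⊆ e ∧ θ T ≤ deg G T

open Classical in
/-- The edges avoiding `Q` that are not saturated. -/
noncomputable def available (θ : Finset V → ℝ) (G : Finset V → ℝ) (Q : Finset V)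
    (w : Finset V → ℝ) (e : Finset V) : ℝ :=
  if Disjoint e Q ∧ ¬ Saturated θ G e then w e else 0

open Classical in
/-- The saturated edges. -/
noncomputable def saturatedPart (θ : Finset V → ℝ) (G : Finset V → ℝ)
    (w : Finset V → ℝ) (e : Finset V) : ℝ :=
  if Saturated θ G e then w e else 0

theorem available_le {w : Finset V → ℝ} (hw : 0 ≤ w) (θ G : Finset V → ℝ) (Q : Finset V) :
    available θ G Q w ≤ w := by
  intro e
  unfold available
  split_ifs
  exacts [le_rfl, hw e]

theorem available_nonneg {w : Finset V → ℝ} (hw : 0 ≤ w) (θ G : Finset V → ℝ) (Q : Finset V) :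
    0 ≤ available θ G Q w := by
  intro e
  unfold available
  split_ifs
  exacts [hw e, le_rfl]

/-- Saturated edges have small weight when the total weight of `G` is small. -/
theorem total_saturatedPart_le {w G B : Finset V → ℝ} {p : ℝ} {s : ℕ} (hw : 0 ≤ w) (hG : 0 ≤ G)
    (hp : 0 < p) (hs : ∀ e, G e ≠ 0 → e.card = s) (hB : ∀ T, T.Nonempty → deg w T ≤ B T) :
    p * total (saturatedPart (fun T => p * B T) G w) ≤ (2 ^ s - 1) * total G := by
  classical
  -- Union bound over the sets `T` that saturate an edge; each satisfies `p * deg w T ≤ p * B T ≤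
  -- deg G T`.
  have h1 : total (saturatedPart (fun T => p * B T) G w) ≤
      ∑ T : Finset V with T.Nonempty, if p * B T ≤ deg G T then deg w T else 0 := by
    have : ∀ T : Finset V, (if p * B T ≤ deg G T then deg w T else 0) =
        ∑ e, if T ⊆ e ∧ p * B T ≤ deg G T then w e else 0 := by
      intro T
      split_ifs with h
      · simp only [h, and_true, deg.eq_1 w, sum_filter]
      · simp only [h, and_false, if_false, sum_const_zero]
    simp only [this]
    rw [sum_comm]
    refine sum_le_sum fun e _ => ?_
    have hnn : ∀ T ∈ univ.filter (Finset.Nonempty (α := V)),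
        0 ≤ if T ⊆ e ∧ p * B T ≤ deg G T then w e else 0 := by
      intro T _
      split_ifs
      exacts [hw e, le_rfl]
    unfold saturatedPart
    split_ifs with h
    · obtain ⟨T, hT, hTe, hTd⟩ := h
      calc w e = if T ⊆ e ∧ p * B T ≤ deg G T then w e else 0 := by simp [hTe, hTd]
        _ ≤ _ := single_le_sum (f := fun T => if T ⊆ e ∧ p * B T ≤ deg G T then w e else 0)
          hnn (by simp [hT])
    · exact sum_nonneg hnn
  calc p * total (saturatedPart (fun T => p * B T) G w)
      ≤ p * ∑ T : Finset V with T.Nonempty, if p * B T ≤ deg G T then deg w T else 0 := by gcongr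
    _ = ∑ T : Finset V with T.Nonempty, p * if p * B T ≤ deg G T then deg w T else 0 :=
        mul_sum ..
    _ ≤ ∑ T : Finset V with T.Nonempty, deg G T := by
        refine sum_le_sum fun T hT => ?_
        split_ifs with h
        · exact (mul_le_mul_of_nonneg_left (hB T (mem_filter.1 hT).2) hp.le).trans h
        · simpa using deg_nonneg hG T
    _ = (2 ^ s - 1) * total G := sum_deg_nonempty hs

/-- Rejecting a vertex loses at most its degree. -/
theorem total_available_reject {w : Finset V → ℝ} (hw : 0 ≤ w) (θ G : Finset V → ℝ)
    (Q : Finset V) (v : V) :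
    total (available θ G Q w) ≤ total (available θ G (insert v Q) w) + deg w {v} := by
  classical
  simp only [total, deg, sum_filter, ← sum_add_distrib]
  refine sum_le_sum fun e _ => ?_
  have := hw e
  simp only [Pi.zero_apply] at this
  unfold available
  by_cases hv : v ∈ e <;> by_cases hQ : Disjoint e Q <;> by_cases hS : Saturated θ G e <;>
    simp [hv, hQ, hS, disjoint_insert_right, this]

/-- Picking a vertex moves its available degree to `G`; whatever else is lost is saturated. -/
theorem total_available_pick {w G G' : Finset V → ℝ} (hw : 0 ≤ w) (hGG : G ≤ G')
    (θ : Finset V → ℝ) (Q : Finset V) (v : V) :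
    total (available θ G Q w) + total (saturatedPart θ G w) ≤
      total (available θ G' (insert v Q) w) + total (saturatedPart θ G' w) +
        deg (available θ G Q w) {v} := by
  classical
  simp only [total, deg, sum_filter, ← sum_add_distrib]
  refine sum_le_sum fun e _ => ?_
  have := hw e
  simp only [Pi.zero_apply] at this
  have hmono : Saturated θ G e → Saturated θ G' e := fun ⟨T, h1, h2, h3⟩ =>
    ⟨T, h1, h2, h3.trans (deg_mono hGG T)⟩
  unfold available saturatedPart
  by_cases hS : Saturated θ G e
  · by_cases hv : v ∈ e <;> by_cases hQ : Disjoint e Q <;>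
      simp [hv, hQ, hS, hmono hS, disjoint_insert_right]
  · by_cases hv : v ∈ e <;> by_cases hQ : Disjoint e Q <;> by_cases hS' : Saturated θ G' e <;>
      simp [hv, hQ, hS, hS', disjoint_insert_right, this]

/-- Truncation at saturation keeps the degrees of `G` below twice the threshold. -/
theorem deg_add_link_le {w G B : Finset V → ℝ} {p : ℝ} (hw : 0 ≤ w) {v : V} {Q T : Finset V}
    (hT : T.Nonempty) (hG : deg G T ≤ 2 * (p * B T))
    (hv : v ∉ T → deg w (insert v T) ≤ p * B T) :
    deg (G + link v (available (fun T => p * B T) G Q w)) T ≤ 2 * (p * B T) := by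
  rw [deg_add]
  by_cases hvT : v ∈ T
  · rw [deg_link_of_mem _ hvT]
    linarith
  rw [deg_link_of_notMem _ hvT]
  -- Once `T` is saturated, no available edge contains it and its degree is frozen. Before that, its
  -- degree is below the threshold and one link adds at most another threshold.
  by_cases hsat : p * B T ≤ deg G T
  · have : deg (available (fun T => p * B T) G Q w) (insert v T) = 0 := by
      refine sum_eq_zero fun e he => ?_
      have hTe : T ⊆ e := (subset_insert v T).trans (mem_filter.1 he).2
      have : Saturated (fun T => p * B T) G e := ⟨T, hT, hTe, hsat⟩
      simp [available, this]
    linarith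
  · have h1 := deg_mono (available_le hw (fun T => p * B T) G Q) (insert v T)
    have h2 := hv hvT
    linarith

end WeightedHypergraph
-- One round of the algorithm
namespace WeightedHypergraph

open Finset QueryTree

variable {V : Type*}

/-- `K` contains no edge of positive weight. -/
def IsFree (w : Finset V → ℝ) (K : Finset V) : Prop := ∀ e, w e ≠ 0 → ¬ e ⊆ K

variable [DecidableEq V]

/-- Every edge of `G` arises from an edge of `w` by deleting a vertex of `X`. -/
def IsLinkOf (X : Finset V) (w G : Finset V → ℝ) : Prop :=
  ∀ e, G e ≠ 0 → ∃ v ∈ X, v ∉ e ∧ w (insert v e) ≠ 0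

/-- Restoring the deleted vertex, which lies in `X ⊆ K`, turns an edge of `G` inside `K` into an
edge of `w` inside `K`. -/
theorem IsFree.of_isLinkOf {X K : Finset V} {w G : Finset V → ℝ} (hK : IsFree w K)
    (hG : IsLinkOf X w G) (hX : X ⊆ K) : IsFree G K := by
  intro e he heK
  obtain ⟨v, hv, -, hw⟩ := hG e he
  exact hK _ hw (insert_subset (hX hv) heK)

variable [Fintype V]

/-- One round of the container algorithm, from an arbitrary intermediate state: vertices of `U`
are queried until either many have been rejected or the links `G` of the picked vertices `X` have
collected enough weight. -/
theorem exists_tree_of_state (w B : Finset V → ℝ) (U : Finset V) (s b : ℕ) (p N β : ℝ)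
    (𝒦 : Set (Finset V)) (Q : Finset V → Finset V → Prop)
    (hw : 0 ≤ w) (hs : ∀ e, w e ≠ 0 → e.card = s + 1) (hpos : 0 < total w)
    (hp : 0 < p) (hp1 : p ≤ 1) (hN : 0 < N) (hpN : p * N = b)
    (hUN : (U.card : ℝ) ≤ N) (hU : ∀ e, w e ≠ 0 → ∃ v ∈ U, v ∈ e)
    (hB : ∀ T, T.Nonempty → deg w T ≤ B T)
    (hlink : ∀ v ∈ U, ∀ T, T.Nonempty → v ∉ T → deg w (insert v T) ≤ p * B T)
    (hβ : ∀ v ∈ U, deg w {v} ≤ β)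
    (hdone : ∀ X Y, X ⊆ U → Y ⊆ U → X.card ≤ b → total w / 2 ≤ Y.card * β → Q X Y)
    (hnext : ∀ X Y G, X ⊆ U → Y ⊆ U → X.card ≤ b → 0 ≤ G → IsLinkOf X w G →
      (∀ T, T.Nonempty → deg G T ≤ 2 * (p * B T)) →
      p * total w ≤ 2 ^ (s + 2) * total G →
      ∃ t : QueryTree V, ∀ K ∈ 𝒦, IsFree G K → Q (X ∪ t.picked K) (Y ∪ t.rejected K))
    (n : ℕ) (X Y : Finset V) (G : Finset V → ℝ) (hn : (U \ (X ∪ Y)).card ≤ n)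
    (hXU : X ⊆ U) (hYU : Y ⊆ U) (hXb : X.card ≤ b) (hG : 0 ≤ G) (hGX : IsLinkOf X w G)
    (hGB : ∀ T, T.Nonempty → deg G T ≤ 2 * (p * B T))
    (hsum : total w ≤ total (available (fun T => p * B T) G (X ∪ Y) w) +
      total (saturatedPart (fun T => p * B T) G w) + Y.card * β + total G)
    (hX : X.card * (total w / (4 * N)) ≤ total G) :
    ∃ t : QueryTree V, ∀ K ∈ 𝒦, IsFree w K → X ⊆ K →
      Q (X ∪ t.picked K) (Y ∪ t.rejected K) := by
  by_cases hY : total w / 2 ≤ Y.card * β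
  · exact ⟨leaf, fun K _ _ _ => by simpa [picked, rejected] using hdone X Y hXU hYU hXb hY⟩
  by_cases hGbig : p * total w ≤ 2 ^ (s + 2) * total G
  · obtain ⟨t, ht⟩ := hnext X Y G hXU hYU hXb hG hGX hGB hGbig
    exact ⟨t, fun K hK hfree hXK => ht K hK (hfree.of_isLinkOf hGX hXK)⟩
  rw [not_le] at hY hGbig
  set θ : Finset V → ℝ := fun T => p * B T with hθ
  set A := available θ G (X ∪ Y) w with hA
  have hGs : ∀ e, G e ≠ 0 → e.card = s := by
    intro e he
    obtain ⟨v, -, hve, hwe⟩ := hGX e he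
    have := hs _ hwe
    rw [card_insert_of_notMem hve] at this
    omega
  have hG0 : 0 ≤ total G := total_nonneg hG
  have h2s : (1 : ℝ) ≤ 2 ^ s := one_le_pow₀ one_le_two
  -- In `2 ^ (s + 2)`, the factor `2 ^ s` pays for `G` and the `2 ^ s - 1` sets charged to each of
  -- its edges; the factor 4 leaves a quarter of the weight.
  have hsat : total (saturatedPart θ G w) + total G ≤ total w / 4 := by
    have h1 := total_saturatedPart_le hw hG hp hGs hB
    have h2 : p * (total (saturatedPart θ G w) + total G) ≤ p * (total w / 4) := by
      have h3 : p * total G ≤ total G := mul_le_of_le_one_left hG0 hp1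
      have h4 : (2 : ℝ) ^ (s + 2) = 4 * 2 ^ s := by ring
      rw [h4] at hGbig
      calc _ ≤ (2 ^ s - 1) * total G + total G := by rw [mul_add]; exact add_le_add h1 h3
        _ = 2 ^ s * total G := by ring
        _ ≤ p * (total w / 4) := by linarith
    exact le_of_mul_le_mul_left h2 hp
  -- Rejections account for less than half of the weight, `G` and saturation for at most a quarter.
  have hAbig : total w / 4 ≤ total A := by linarith
  have hw0 : ∀ e, A e ≠ 0 → w e ≠ 0 ∧ Disjoint e (X ∪ Y) := by
    intro e he
    rw [hA, available] at he
    split_ifs at he with h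
    · exact ⟨he, h.1⟩
    · exact absurd rfl he
  obtain ⟨v, hvU, hv⟩ := exists_le_deg (available_nonneg hw θ G (X ∪ Y)) hN hUN
    (fun e he => hU e (hw0 e he).1) (by linarith : 0 < total A)
  have hvdeg : total w / (4 * N) ≤ deg A {v} := by
    refine le_trans ?_ hv
    rw [← div_div]
    gcongr
  have hvQ : v ∉ X ∪ Y := by
    intro hvQ
    have : deg A {v} = 0 := by
      refine sum_eq_zero fun e he => ?_
      by_contra hne
      exact disjoint_left.1 (hw0 e hne).2 (by simpa using he) hvQ
    have : 0 < total w / (4 * N) := by positivity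
    linarith
  have hvX : v ∉ X := fun h => hvQ (mem_union_left _ h)
  have hvY : v ∉ Y := fun h => hvQ (mem_union_right _ h)
  have hlt : ∀ S, S = insert v (X ∪ Y) → (U \ S).card < (U \ (X ∪ Y)).card := by
    rintro _ rfl
    refine card_lt_card ⟨sdiff_subset_sdiff le_rfl (subset_insert _ _), fun h => ?_⟩
    have := h (mem_sdiff.2 ⟨hvU, hvQ⟩)
    simp at this
  have hYv : X ∪ insert v Y = insert v (X ∪ Y) := union_insert ..
  have hXv : insert v X ∪ Y = insert v (X ∪ Y) := insert_union ..
  -- Since `p * N = b`, `b` picks would give `total G ≥ p * total w / 4`, contrary to `hGbig`.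
  have hXlt : X.card < b := by
    have h1 : X.card * (total w / (4 * N)) * (2 ^ (s + 2) * N) < p * total w * N := by
      calc _ ≤ total G * (2 ^ (s + 2) * N) := by gcongr
        _ = 2 ^ (s + 2) * total G * N := by ring
        _ < _ := by gcongr
    have h2 : X.card * (total w / (4 * N)) * (2 ^ (s + 2) * N) = X.card * 2 ^ s * total w := by
      field_simp
      ring
    rw [h2, mul_right_comm p, hpN] at h1
    have h3 : (X.card : ℝ) * 2 ^ s < b := lt_of_mul_lt_mul_right h1 hpos.le
    have h4 : (X.card : ℝ) ≤ X.card * 2 ^ s := le_mul_of_one_le_right (by positivity) h2s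
    exact_mod_cast h4.trans_lt h3
  cases n with
  | zero => have := hlt _ rfl; omega
  | succ n =>
    have hnn := hlt _ rfl
    have hA0 : 0 ≤ A := available_nonneg hw θ G (X ∪ Y)
    have hL0 := link_nonneg hA0 v
    obtain ⟨yes, hyes⟩ := exists_tree_of_state w B U s b p N β 𝒦 Q hw hs hpos hp hp1 hN hpN hUN hU
      hB hlink hβ hdone hnext n (insert v X) Y (G + link v A) (by rw [hXv]; omega)
      (insert_subset hvU hXU) hYU (by rw [card_insert_of_notMem hvX]; omega)
      (add_nonneg hG hL0)
      (by
        intro e he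
        by_cases hGe : G e = 0
        · rw [Pi.add_apply, hGe, zero_add, link] at he
          split_ifs at he with hve
          · exact absurd rfl he
          · exact ⟨v, mem_insert_self _ _, hve, (hw0 _ he).1⟩
        · obtain ⟨u, hu, h⟩ := hGX e hGe
          exact ⟨u, mem_insert_of_mem hu, h⟩)
      (fun T hT => deg_add_link_le hw hT (hGB T hT) (hlink v hvU T hT))
      (by
        have := total_available_pick hw (le_add_of_nonneg_right hL0 : G ≤ G + link v A) θ (X ∪ Y) v
        rw [hXv, total_add, total_link]
        linarith)
      (by
        rw [card_insert_of_notMem hvX, total_add, total_link]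
        push_cast
        linarith)
    obtain ⟨no, hno⟩ := exists_tree_of_state w B U s b p N β 𝒦 Q hw hs hpos hp hp1 hN hpN hUN hU
      hB hlink hβ hdone hnext n X (insert v Y) G (by rw [hYv]; omega)
      hXU (insert_subset hvU hYU) hXb hG hGX hGB
      (by
        have := total_available_reject hw θ G (X ∪ Y) v
        have := hβ v hvU
        rw [hYv, card_insert_of_notMem hvY]
        push_cast
        linarith)
      hX
    refine ⟨query v yes no, fun K hK hfree hXK => ?_⟩
    by_cases hvK : v ∈ K
    · simpa [picked, rejected, hvK] using hyes K hK hfree (insert_subset hvK hXK)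
    · simpa [picked, rejected, hvK] using hno K hK hfree hXK

/-- One round of the container algorithm. -/
theorem exists_tree_of_next (w B : Finset V → ℝ) (U : Finset V) (s b : ℕ) (p N β : ℝ)
    (𝒦 : Set (Finset V)) (Q : Finset V → Finset V → Prop)
    (hw : 0 ≤ w) (hs : ∀ e, w e ≠ 0 → e.card = s + 1) (hpos : 0 < total w)
    (hp : 0 < p) (hp1 : p ≤ 1) (hN : 0 < N) (hpN : p * N = b)
    (hUN : (U.card : ℝ) ≤ N) (hU : ∀ e, w e ≠ 0 → ∃ v ∈ U, v ∈ e)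
    (hB : ∀ T, T.Nonempty → deg w T ≤ B T)
    (hlink : ∀ v ∈ U, ∀ T, T.Nonempty → v ∉ T → deg w (insert v T) ≤ p * B T)
    (hβ : ∀ v ∈ U, deg w {v} ≤ β)
    (hdone : ∀ X Y, X ⊆ U → Y ⊆ U → X.card ≤ b → total w / 2 ≤ Y.card * β → Q X Y)
    (hnext : ∀ X Y G, X ⊆ U → Y ⊆ U → X.card ≤ b → 0 ≤ G → IsLinkOf X w G →
      (∀ T, T.Nonempty → deg G T ≤ 2 * (p * B T)) →
      p * total w ≤ 2 ^ (s + 2) * total G →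
      ∃ t : QueryTree V, ∀ K ∈ 𝒦, IsFree G K → Q (X ∪ t.picked K) (Y ∪ t.rejected K)) :
    ∃ t : QueryTree V, ∀ K ∈ 𝒦, IsFree w K → Q (t.picked K) (t.rejected K) := by
  have hB0 : ∀ T : Finset V, T.Nonempty → 0 ≤ B T := fun T hT => (deg_nonneg hw T).trans (hB T hT)
  obtain ⟨t, ht⟩ := exists_tree_of_state w B U s b p N β 𝒦 Q hw hs hpos hp hp1 hN hpN hUN hU
    hB hlink hβ hdone hnext _ ∅ ∅ 0 le_rfl (by simp) (by simp) (by simp) le_rfl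
    (fun e he => absurd rfl he)
    (fun T hT => by simpa [deg] using mul_nonneg hp.le (hB0 T hT))
    (by
      classical
      simp only [total, ← sum_add_distrib, card_empty, Nat.cast_zero, zero_mul, add_zero,
        Pi.zero_apply, sum_const_zero]
      refine sum_le_sum fun e _ => ?_
      unfold available saturatedPart
      -- Even for `G = 0` an edge is saturated if some bound `B T` vanishes.
      by_cases h : Saturated (fun T => p * B T) 0 e <;> simp [h])
    (by simp [total])
  exact ⟨t, fun K hK hfree => by simpa using ht K hK hfree (by simp)⟩

end WeightedHypergraph
-- Iterating the rounds, for `V₀` and for `V₁`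
namespace WeightedHypergraph

open Finset QueryTree

section TwoParts

variable {V₀ V₁ : Type*} [Fintype V₁]

/-- The shape of the codegree bounds: the bound for `T` is a constant multiple of `scale b m q T`. -/
noncomputable def scale (b m q : ℕ) (T : Finset (V₀ ⊕ V₁)) : ℝ :=
  ((b : ℝ) / m) ^ T.toLeft.card * ((b : ℝ) / Fintype.card V₁) ^ T.toRight.card *
    ((m : ℝ) / q) ^ (if 0 < T.toLeft.card then 1 else 0)

theorem scale_nonneg (b m q : ℕ) (T : Finset (V₀ ⊕ V₁)) : 0 ≤ scale b m q T := by
  unfold scale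
  positivity

theorem scale_singleton_inr (b m q : ℕ) (v : V₁) :
    scale b m q ({Sum.inr v} : Finset (V₀ ⊕ V₁)) = (b : ℝ) / Fintype.card V₁ := by
  have h0 : ({Sum.inr v} : Finset (V₀ ⊕ V₁)).toLeft = ∅ := by ext; simp
  have h1 : ({Sum.inr v} : Finset (V₀ ⊕ V₁)).toRight = {v} := by ext; simp
  simp [scale, h0, h1]

theorem scale_singleton_inl {b m q : ℕ} (hm : 0 < m) (v : V₀) :
    scale b m q ({Sum.inl v} : Finset (V₀ ⊕ V₁)) = (b : ℝ) / q := by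
  have h0 : ({Sum.inl v} : Finset (V₀ ⊕ V₁)).toLeft = {v} := by ext; simp
  have h1 : ({Sum.inl v} : Finset (V₀ ⊕ V₁)).toRight = ∅ := by ext; simp
  have : (m : ℝ) ≠ 0 := by positivity
  simp [scale, h0, h1]
  field_simp

variable [DecidableEq V₀] [DecidableEq V₁]

theorem scale_insert_inr (b m q : ℕ) {v : V₁} {T : Finset (V₀ ⊕ V₁)} (hv : Sum.inr v ∉ T) :
    scale b m q (insert (Sum.inr v) T) = (b : ℝ) / Fintype.card V₁ * scale b m q T := by
  have hv' : v ∉ T.toRight := by simpa using hv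
  simp only [scale, toLeft_insert_inr, toRight_insert_inr, card_insert_of_notMem hv', pow_succ]
  ring

/-- A left vertex in `T` means that the factor `m / q` is already present on both sides. -/
theorem scale_insert_inl (b m q : ℕ) {v : V₀} {T : Finset (V₀ ⊕ V₁)} (hv : Sum.inl v ∉ T)
    (hT : T.toLeft.Nonempty) :
    scale b m q (insert (Sum.inl v) T) = (b : ℝ) / m * scale b m q T := by
  have hv' : v ∉ T.toLeft := by simpa using hv
  have h0 : 0 < T.toLeft.card := hT.card_pos
  simp only [scale, toLeft_insert_inl, toRight_insert_inl, card_insert_of_notMem hv', pow_succ, h0,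
    Nat.succ_pos, if_true]
  ring

/-- The requirements on the picked vertices `S` and the rejected vertices `D`. -/
def IsContainerPair (τ : ℝ) (b q i₀ i₁ : ℕ) (S D : Finset (V₀ ⊕ V₁)) : Prop :=
  S.toLeft.card ≤ i₀ * b ∧ S.toRight.card ≤ i₁ * b ∧
    (τ * q ≤ D.toLeft.card ∨ S.toLeft = ∅ ∧ τ * Fintype.card V₁ ≤ D.toRight.card)

/-- A `V₁` round picks no left vertex, so the alternative `S.toLeft = ∅` survives it. -/
theorem IsContainerPair.union_right {τ : ℝ} {b q i₀ i₁ : ℕ} {S D X Y : Finset (V₀ ⊕ V₁)}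
    (h : IsContainerPair τ b q i₀ i₁ S D) (hX : X.toLeft = ∅) (hXb : X.card ≤ b) :
    IsContainerPair τ b q i₀ (i₁ + 1) (X ∪ S) (Y ∪ D) := by
  obtain ⟨h1, h2, h3⟩ := h
  simp only [IsContainerPair, toLeft_union, toRight_union, hX, empty_union]
  refine ⟨h1, ?_, h3.imp (fun h => h.trans ?_) fun h => ⟨h.1, h.2.trans ?_⟩⟩
  · have := card_union_le X.toRight S.toRight
    have := X.card_toRight_le
    rw [Nat.succ_mul]
    omega
  · exact_mod_cast card_le_card subset_union_right
  · exact_mod_cast card_le_card subset_union_right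

/-- The numerical condition on `τ` survives a round of the algorithm. -/
theorem threshold_next {τ M p b e e' : ℝ} {s : ℕ} (hτ : 0 ≤ τ) (hM : 0 ≤ M) (hp : 0 ≤ p)
    (hb : 0 ≤ b) (hs : s ≠ 0) (h : τ * (M * b) * 2 ^ ((s + 1) * (s + 1 + 1)) ≤ 2 * e)
    (he : p * e ≤ 2 ^ (s + 2) * e') :
    τ * (2 * p * M * b) * 2 ^ (s * (s + 1)) ≤ 2 * e' := by
  -- A round doubles `M` and loses `2 ^ (s + 2)` in weight; the exponents differ by `2 * (s + 1)`,
  -- which is at least `s + 3` once `s ≥ 1`.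
  have h0 : (2 : ℝ) ^ (s * (s + 1)) * 2 * 2 ^ (s + 2) ≤ 2 ^ ((s + 1) * (s + 1 + 1)) := by
    rw [← pow_succ, ← pow_add]
    refine pow_le_pow_right₀ one_le_two ?_
    have : 1 ≤ s := Nat.one_le_iff_ne_zero.2 hs
    nlinarith
  have h1 : 2 ^ (s + 2) * (τ * (2 * p * M * b) * 2 ^ (s * (s + 1))) ≤ 2 ^ (s + 2) * (2 * e') := by
    calc _ = p * (τ * (M * b) * (2 ^ (s * (s + 1)) * 2 * 2 ^ (s + 2))) := by ring
      _ ≤ p * (τ * (M * b) * 2 ^ ((s + 1) * (s + 1 + 1))) := by gcongr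
      _ ≤ p * (2 * e) := by gcongr
      _ ≤ _ := by linarith
  exact le_of_mul_le_mul_left h1 (by positivity)

/-- Rejecting vertices of total degree at least half of all edges means rejecting many vertices. -/
theorem threshold_done {τ M b N e k : ℝ} {n : ℕ} (hτ : 0 ≤ τ) (hM : 0 < M) (hb : 0 < b)
    (hN : 0 < N) (h : τ * (M * b) * 2 ^ ((n + 1) * (n + 1 + 1)) ≤ 2 * e)
    (he : e / 2 ≤ k * (M * (b / N))) : τ * N ≤ k := by
  have h0 : (2 : ℝ) ^ 2 ≤ 2 ^ ((n + 1) * (n + 1 + 1)) :=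
    pow_le_pow_right₀ one_le_two (by nlinarith)
  have h1 : τ * (M * b) * 2 ^ 2 ≤ τ * (M * b) * 2 ^ ((n + 1) * (n + 1 + 1)) := by gcongr
  have h2 : τ * (M * b) ≤ k * (M * (b / N)) := by linarith
  have h3 : k * (M * (b / N)) = k / N * (M * b) := by ring
  rw [h3] at h2
  exact (le_div_iff₀ hN).1 (le_of_mul_le_mul_right h2 (by positivity))

variable [Fintype V₀]

/-- The container algorithm for uniform weighted hypergraphs all of whose vertices lie in `V₀`. -/
theorem exists_tree_left {b m q : ℕ} {τ : ℝ} (hb : 0 < b) (hm : 0 < m) (hq : 0 < q)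
    (hbm : b ≤ m) (hτ0 : 0 ≤ τ) (i₀ : ℕ) (w : Finset (V₀ ⊕ V₁) → ℝ) (M : ℝ)
    (hw : 0 ≤ w) (hM : 0 < M) (hu : ∀ e, w e ≠ 0 → e.toLeft.card = i₀ ∧ e.toRight = ∅)
    (hpos : 0 < total w) (hdeg : ∀ T, T.Nonempty → deg w T ≤ M * scale b m q T)
    (hτ : i₀ ≠ 0 → τ * (M * b) * 2 ^ (i₀ * (i₀ + 1)) ≤ 2 * total w) :
    ∃ t : QueryTree (V₀ ⊕ V₁), ∀ K ∈ {K : Finset (V₀ ⊕ V₁) | K.toLeftᶜ.card ≤ m}, IsFree w K →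
      τ * q ≤ (t.rejected K).toLeft.card ∧ (t.picked K).toLeft.card ≤ i₀ * b ∧
        (t.picked K).toRight = ∅ := by
  induction i₀ generalizing w M with
  | zero =>
    -- The only possible edge is `∅`, which lies in every `K`.
    refine ⟨leaf, fun K _ hK => absurd hpos ?_⟩
    have : total w = 0 := sum_eq_zero fun e _ => by
      by_contra he
      obtain ⟨h0, h1⟩ := hu e he
      rw [card_eq_zero] at h0
      have : e = ∅ := by rw [← toLeft_disjSum_toRight (u := e), h0, h1]; rfl
      exact hK e he (this ▸ empty_subset K)
    exact this.not_gt
  | succ i ih =>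
    -- All edges lie in `V₀` and none lies in `K₀`, so the at most `m` vertices of `V₀ ∖ K₀` hit
    -- every edge. One `K₀` serves for all `K`, so the tree does not depend on `K`; if there is
    -- none, the claim is vacuous.
    by_cases hex : ∃ K₀ : Finset (V₀ ⊕ V₁), K₀.toLeftᶜ.card ≤ m ∧ IsFree w K₀
    swap
    · exact ⟨leaf, fun K hK hfree => absurd ⟨K, hK, hfree⟩ hex⟩
    obtain ⟨K₀, hK₀, hfree₀⟩ := hex
    have hb' : (0 : ℝ) < b := by exact_mod_cast hb
    have hm' : (0 : ℝ) < m := by exact_mod_cast hm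
    have hq' : (0 : ℝ) < q := by exact_mod_cast hq
    have hright : ∀ X : Finset (V₀ ⊕ V₁), X ⊆ K₀.toLeftᶜ.map Function.Embedding.inl →
        X.toRight = ∅ := by
      intro X hX
      ext v
      simp only [mem_toRight, notMem_empty, iff_false]
      intro hv
      simpa using hX hv
    refine exists_tree_of_next w (fun T => M * scale b m q T)
      (K₀.toLeftᶜ.map Function.Embedding.inl) i b (b / m) m (M * (b / q)) _
      (fun S D => τ * q ≤ D.toLeft.card ∧ S.toLeft.card ≤ (i + 1) * b ∧ S.toRight = ∅) hw
      (fun e he => ?_) hpos (by positivity) ?_ hm' (div_mul_cancel₀ _ hm'.ne') ?_ ?_ hdeg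
      ?_ ?_ ?_ ?_
    · rw [← card_toLeft_add_card_toRight, (hu e he).1, (hu e he).2, card_empty]
    · rw [div_le_one hm']
      exact_mod_cast hbm
    · rw [card_map]
      exact_mod_cast hK₀
    · intro e he
      obtain ⟨v, hve, hvK⟩ := not_subset.1 (hfree₀ e he)
      have hr := (hu e he).2
      rcases v with v | v
      · exact ⟨Sum.inl v, by simpa using hvK, hve⟩
      · have : v ∈ e.toRight := by simpa using hve
        simp [hr] at this
    · intro v hv T hT hvT
      obtain ⟨v, -, rfl⟩ := mem_map.1 hv
      simp only [Function.Embedding.inl_apply] at hvT ⊢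
      by_cases hTl : T.toLeft.Nonempty
      · have := hdeg _ (insert_nonempty (Sum.inl v) T)
        rw [scale_insert_inl b m q hvT hTl] at this
        linarith
      · have h0 : deg w (insert (Sum.inl v) T) = 0 := by
          refine sum_eq_zero fun e he => ?_
          by_contra hne
          have hsub := toRight_subset_toRight (mem_filter.1 he).2
          rw [(hu e hne).2, toRight_insert_inl, subset_empty] at hsub
          rw [not_nonempty_iff_eq_empty] at hTl
          rw [← toLeft_disjSum_toRight (u := T), hsub, hTl] at hT
          exact absurd hT (by simp)
        rw [h0]
        have := scale_nonneg b m q T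
        positivity
    · intro v hv
      obtain ⟨v, -, rfl⟩ := mem_map.1 hv
      have := hdeg _ (singleton_nonempty (Sum.inl v))
      rwa [scale_singleton_inl hm] at this
    · intro X Y hX hY hXb hYd
      have hYc : Y.toLeft.card = Y.card := by
        rw [← card_toLeft_add_card_toRight (u := Y), hright Y hY, card_empty, add_zero]
      refine ⟨?_, ?_, hright X hX⟩
      · rw [hYc]
        exact threshold_done hτ0 hM hb' hq' (hτ (Nat.succ_ne_zero i)) hYd
      · have := X.card_toLeft_le
        rw [Nat.succ_mul]
        omega
    · intro X Y G hX hY hXb hG hGX hGB hGt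
      have hGpos : 0 < total G := by
        have : 0 < (b : ℝ) / m * total w := by positivity
        exact pos_of_mul_pos_right (this.trans_le hGt) (by positivity)
      obtain ⟨t, ht⟩ := ih G (2 * (b / m) * M) hG (by positivity)
        (by
          intro e he
          obtain ⟨v, hv, hve, hwe⟩ := hGX e he
          obtain ⟨v, -, rfl⟩ := mem_map.1 (hX hv)
          obtain ⟨h0, h1⟩ := hu _ hwe
          simp only [Function.Embedding.inl_apply] at h0 h1 hve
          have hve' : v ∉ e.toLeft := by simpa using hve
          rw [toLeft_insert_inl, card_insert_of_notMem hve'] at h0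
          rw [toRight_insert_inl] at h1
          exact ⟨by omega, h1⟩)
        hGpos (fun T hT => (hGB T hT).trans_eq (by ring))
        (fun hi => threshold_next hτ0 hM.le (by positivity) hb'.le hi (hτ (Nat.succ_ne_zero i)) hGt)
      refine ⟨t, fun K hK hfree => ?_⟩
      obtain ⟨h1, h2, h3⟩ := ht K hK hfree
      simp only [toLeft_union, toRight_union, hright X hX, h3, empty_union, and_true]
      refine ⟨h1.trans ?_, ?_⟩
      · exact_mod_cast card_le_card subset_union_right
      · have := card_union_le X.toLeft (t.picked K).toLeft
        have := X.card_toLeft_le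
        rw [Nat.succ_mul]
        omega

/-- The container algorithm for uniform weighted hypergraphs. -/
theorem exists_tree {b m q : ℕ} {τ : ℝ} (hb : 0 < b) (hm : 0 < m) (hq : 0 < q)
    (hbm : b ≤ m) (hbV : b ≤ Fintype.card V₁) (hτ0 : 0 ≤ τ) (i₀ i₁ : ℕ)
    (w : Finset (V₀ ⊕ V₁) → ℝ) (M : ℝ)
    (hw : 0 ≤ w) (hM : 0 < M) (hu : ∀ e, w e ≠ 0 → e.toLeft.card = i₀ ∧ e.toRight.card = i₁)
    (hpos : 0 < total w) (hdeg : ∀ T, T.Nonempty → deg w T ≤ M * scale b m q T)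
    (hτ : i₀ + i₁ ≠ 0 → τ * (M * b) * 2 ^ ((i₀ + i₁) * (i₀ + i₁ + 1)) ≤ 2 * total w) :
    ∃ t : QueryTree (V₀ ⊕ V₁), ∀ K ∈ {K : Finset (V₀ ⊕ V₁) | K.toLeftᶜ.card ≤ m}, IsFree w K →
      IsContainerPair τ b q i₀ i₁ (t.picked K) (t.rejected K) := by
  induction i₁ generalizing w M with
  | zero =>
    obtain ⟨t, ht⟩ := exists_tree_left hb hm hq hbm hτ0 i₀ w M hw hM
      (fun e he => ⟨(hu e he).1, card_eq_zero.1 (hu e he).2⟩) hpos hdeg hτ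
    refine ⟨t, fun K hK hfree => ?_⟩
    obtain ⟨h1, h2, h3⟩ := ht K hK hfree
    exact ⟨h2, by simp [h3], Or.inl h1⟩
  | succ i ih =>
    have hb' : (0 : ℝ) < b := by exact_mod_cast hb
    have hV' : (0 : ℝ) < Fintype.card V₁ := by exact_mod_cast hb.trans_le hbV
    have hleft : ∀ X : Finset (V₀ ⊕ V₁), X ⊆ univ.map Function.Embedding.inr →
        X.toLeft = ∅ := by
      intro X hX
      ext v
      simp only [mem_toLeft, notMem_empty, iff_false]
      intro hv
      simpa using hX hv
    refine exists_tree_of_next w (fun T => M * scale b m q T)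
      (univ.map Function.Embedding.inr) (i₀ + i) b (b / Fintype.card V₁) (Fintype.card V₁)
      (M * (b / Fintype.card V₁)) _ (IsContainerPair τ b q i₀ (i + 1)) hw
      (fun e he => ?_) hpos (by positivity) ?_ hV' (div_mul_cancel₀ _ hV'.ne') ?_ ?_ hdeg
      ?_ ?_ ?_ ?_
    · rw [← card_toLeft_add_card_toRight, (hu e he).1, (hu e he).2, add_assoc]
    · rw [div_le_one hV']
      exact_mod_cast hbV
    · rw [card_map, card_univ]
    · intro e he
      have : e.toRight.Nonempty := by
        rw [← card_pos, (hu e he).2]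
        exact Nat.succ_pos i
      obtain ⟨v, hv⟩ := this
      exact ⟨Sum.inr v, by simp, by simpa using hv⟩
    · intro v hv T hT hvT
      obtain ⟨v, -, rfl⟩ := mem_map.1 hv
      simp only [Function.Embedding.inr_apply] at hvT ⊢
      have := hdeg _ (insert_nonempty (Sum.inr v) T)
      rw [scale_insert_inr b m q hvT] at this
      linarith
    · intro v hv
      obtain ⟨v, -, rfl⟩ := mem_map.1 hv
      have := hdeg _ (singleton_nonempty (Sum.inr v))
      rwa [scale_singleton_inr] at this
    · intro X Y hX hY hXb hYd
      have hYc : Y.toRight.card = Y.card := by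
        rw [← card_toLeft_add_card_toRight (u := Y), hleft Y hY, card_empty, zero_add]
      refine ⟨by simp [hleft X hX], ?_, Or.inr ⟨hleft X hX, ?_⟩⟩
      · have := X.card_toRight_le
        rw [Nat.succ_mul]
        omega
      · rw [hYc]
        exact threshold_done hτ0 hM hb' hV' (hτ (Nat.succ_ne_zero (i₀ + i))) hYd
    · intro X Y G hX hY hXb hG hGX hGB hGt
      have hGpos : 0 < total G := by
        have : 0 < (b : ℝ) / Fintype.card V₁ * total w := by positivity
        exact pos_of_mul_pos_right (this.trans_le hGt) (by positivity)
      obtain ⟨t, ht⟩ := ih G (2 * (b / Fintype.card V₁) * M) hG (by positivity)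
        (by
          intro e he
          obtain ⟨v, hv, hve, hwe⟩ := hGX e he
          obtain ⟨v, -, rfl⟩ := mem_map.1 (hX hv)
          obtain ⟨h0, h1⟩ := hu _ hwe
          simp only [Function.Embedding.inr_apply] at h0 h1 hve
          have hve' : v ∉ e.toRight := by simpa using hve
          rw [toRight_insert_inr, card_insert_of_notMem hve'] at h1
          rw [toLeft_insert_inr] at h0
          exact ⟨h0, by omega⟩)
        hGpos (fun T hT => (hGB T hT).trans_eq (by ring))
        (fun hi => threshold_next hτ0 hM.le (by positivity) hb'.le hi
          (hτ (Nat.succ_ne_zero (i₀ + i))) hGt)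
      exact ⟨t, fun K hK hfree => (ht K hK hfree).union_right (hleft X hX) hXb⟩

end TwoParts

end WeightedHypergraph
-- Popular edge types and the passage to weights
namespace BoundedHypergraph

open Finset WeightedHypergraph

variable {V₀ V₁ : Type*} {r₀ r₁ : ℕ}

/-- The edges with exactly `s₀` vertices in `V₀` and `s₁` vertices in `V₁`. -/
def edgesOfType (H : BoundedHypergraph V₀ V₁ r₀ r₁) (s₀ s₁ : ℕ) : Finset (Finset V₀ × Finset V₁) :=
  H.edges.filter fun e => e.1.card = s₀ ∧ e.2.card = s₁

/-- Some type of edges is popular: the full type if it has at least half of all edges, and a smaller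
type otherwise. -/
theorem exists_popular_type (H : BoundedHypergraph V₀ V₁ r₀ r₁) (hH : H.edges.Nonempty) :
    ∃ s₀ s₁, s₀ ≤ r₀ ∧ s₁ ≤ r₁ ∧ (H.edgesOfType s₀ s₁).Nonempty ∧
      (H.edges.card : ℝ) * 2 ^ ((s₀ + s₁) * (s₀ + s₁ + 1)) ≤
        2 * 2 ^ ((r₀ + r₁ + 1) * (r₀ + r₁)) * (H.edgesOfType s₀ s₁).card := by
  have hpos : (0 : ℝ) < H.edges.card := by exact_mod_cast hH.card_pos
  have key : ∀ s₀ s₁, s₀ ≤ r₀ → s₁ ≤ r₁ → (H.edges.card : ℝ) * 2 ^ ((s₀ + s₁) * (s₀ + s₁ + 1)) ≤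
        2 * 2 ^ ((r₀ + r₁ + 1) * (r₀ + r₁)) * (H.edgesOfType s₀ s₁).card →
      ∃ s₀ s₁, s₀ ≤ r₀ ∧ s₁ ≤ r₁ ∧ (H.edgesOfType s₀ s₁).Nonempty ∧
      (H.edges.card : ℝ) * 2 ^ ((s₀ + s₁) * (s₀ + s₁ + 1)) ≤
        2 * 2 ^ ((r₀ + r₁ + 1) * (r₀ + r₁)) * (H.edgesOfType s₀ s₁).card := by
    intro s₀ s₁ h0 h1 h
    refine ⟨s₀, s₁, h0, h1, ?_, h⟩
    rw [nonempty_iff_ne_empty]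
    intro he
    rw [he, card_empty, Nat.cast_zero, mul_zero] at h
    have : 0 < (H.edges.card : ℝ) * 2 ^ ((s₀ + s₁) * (s₀ + s₁ + 1)) := by positivity
    linarith
  by_cases hfull : (H.edges.card : ℝ) ≤ 2 * (H.edgesOfType r₀ r₁).card
  · refine key r₀ r₁ le_rfl le_rfl ?_
    rw [mul_comm (r₀ + r₁) (r₀ + r₁ + 1)]
    calc _ ≤ 2 * ((H.edgesOfType r₀ r₁).card : ℝ) * 2 ^ ((r₀ + r₁ + 1) * (r₀ + r₁)) := by gcongr
      _ = _ := by ring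
  -- Otherwise the smaller types, at most `2 ^ (r₀ + r₁)` many, share more than half of the edges.
  set types := (range (r₀ + 1) ×ˢ range (r₁ + 1)).erase (r₀, r₁) with htypes
  have hsum : (H.edges.card : ℝ) ≤ (H.edgesOfType r₀ r₁).card +
      ∑ s ∈ types, ((H.edgesOfType s.1 s.2).card : ℝ) := by
    have hmem : (r₀, r₁) ∈ range (r₀ + 1) ×ˢ range (r₁ + 1) := by simp
    rw [htypes, add_sum_erase _ (fun s => ((H.edgesOfType s.1 s.2).card : ℝ)) hmem]
    have := card_eq_sum_card_fiberwise (s := H.edges) (f := fun e => (e.1.card, e.2.card))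
      (t := range (r₀ + 1) ×ˢ range (r₁ + 1)) (fun e he => by
        have := H.card_le e he
        simp only [coe_product, coe_range, Set.mem_prod, Set.mem_Iio]
        omega)
    rw [this]
    push_cast
    refine sum_le_sum fun s _ => ?_
    simp [edgesOfType, Prod.ext_iff]
  have hcard : (types.card : ℝ) ≤ 2 ^ (r₀ + r₁) := by
    have h1 : types.card ≤ (r₀ + 1) * (r₁ + 1) := by
      refine card_erase_le.trans_eq ?_
      rw [card_product, card_range, card_range]
    have h2 : (r₀ + 1) * (r₁ + 1) ≤ 2 ^ r₀ * 2 ^ r₁ :=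
      Nat.mul_le_mul r₀.lt_two_pow_self r₁.lt_two_pow_self
    rw [pow_add]
    exact_mod_cast h1.trans h2
  obtain ⟨s, hs, hsc⟩ : ∃ s ∈ types,
      (H.edges.card : ℝ) ≤ 2 ^ (r₀ + r₁ + 1) * (H.edgesOfType s.1 s.2).card := by
    by_contra! hcon
    have h1 : ∑ s ∈ types, ((H.edgesOfType s.1 s.2).card : ℝ) ≤
        ∑ s ∈ types, (H.edges.card : ℝ) / 2 ^ (r₀ + r₁ + 1) := by
      refine sum_le_sum fun s hs => ?_
      rw [le_div_iff₀ (by positivity)]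
      linarith [hcon s hs]
    have h2 : (types.card : ℝ) * ((H.edges.card : ℝ) / 2 ^ (r₀ + r₁ + 1)) ≤ H.edges.card / 2 := by
      calc _ ≤ 2 ^ (r₀ + r₁) * ((H.edges.card : ℝ) / 2 ^ (r₀ + r₁ + 1)) := by gcongr
        _ = _ := by
          rw [pow_succ]
          field_simp
    rw [sum_const, nsmul_eq_mul] at h1
    linarith
  obtain ⟨hne, hs⟩ := mem_erase.1 hs
  obtain ⟨h0, h1⟩ := mem_product.1 hs
  have h0 : s.1 ≤ r₀ := Nat.lt_succ_iff.1 (mem_range.1 h0)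
  have h1 : s.2 ≤ r₁ := Nat.lt_succ_iff.1 (mem_range.1 h1)
  have hlt : s.1 + s.2 + 1 ≤ r₀ + r₁ := by
    by_contra h
    exact hne (Prod.ext (by omega) (by omega))
  refine key s.1 s.2 h0 h1 ?_
  -- With `r = r₀ + r₁` and `n = s.1 + s.2 ≤ r - 1`, the left exponent `r + 1 + n * (n + 1)` is at
  -- most `r ^ 2 + 1`.
  have hexp : (2 : ℝ) ^ (r₀ + r₁ + 1) * 2 ^ ((s.1 + s.2) * (s.1 + s.2 + 1)) ≤
      2 * 2 ^ ((r₀ + r₁ + 1) * (r₀ + r₁)) := by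
    rw [← pow_add, ← pow_succ']
    refine pow_le_pow_right₀ one_le_two ?_
    nlinarith
  calc (H.edges.card : ℝ) * 2 ^ ((s.1 + s.2) * (s.1 + s.2 + 1))
      ≤ 2 ^ (r₀ + r₁ + 1) * (H.edgesOfType s.1 s.2).card *
        2 ^ ((s.1 + s.2) * (s.1 + s.2 + 1)) := by gcongr
    _ = 2 ^ (r₀ + r₁ + 1) * 2 ^ ((s.1 + s.2) * (s.1 + s.2 + 1)) *
        (H.edgesOfType s.1 s.2).card := by ring
    _ ≤ _ := by gcongr

variable [DecidableEq V₀] [DecidableEq V₁]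

/-- The indicator function of a family of pairs, as a weighted hypergraph on the disjoint union. -/
def weight (F : Finset (Finset V₀ × Finset V₁)) (e : Finset (V₀ ⊕ V₁)) : ℝ :=
  if (e.toLeft, e.toRight) ∈ F then 1 else 0

theorem weight_ne_zero {F : Finset (Finset V₀ × Finset V₁)} {e : Finset (V₀ ⊕ V₁)} :
    weight F e ≠ 0 ↔ (e.toLeft, e.toRight) ∈ F := by
  simp [weight]

variable [Fintype V₀] [Fintype V₁]

theorem total_weight (F : Finset (Finset V₀ × Finset V₁)) : total (weight F) = F.card := by
  simp only [total, weight, sum_boole]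
  congr 1
  refine card_nbij' (fun e => (e.toLeft, e.toRight)) (fun e => e.1.disjSum e.2) ?_ ?_ ?_ ?_
  · intro e he
    simpa using he
  · intro e he
    simpa using he
  · intro e _
    exact toLeft_disjSum_toRight
  · intro e _
    simp

theorem deg_weight (F : Finset (Finset V₀ × Finset V₁)) (T : Finset (V₀ ⊕ V₁)) :
    deg (weight F) T = (F.filter fun e => T.toLeft ⊆ e.1 ∧ T.toRight ⊆ e.2).card := by
  rw [← total_weight, deg, sum_filter, total]
  refine sum_congr rfl fun e _ => ?_
  have : T ⊆ e ↔ T.toLeft ⊆ e.toLeft ∧ T.toRight ⊆ e.toRight := by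
    rw [← disjSum_subset, toLeft_disjSum_toRight]
  simp only [weight, mem_filter, this]
  split_ifs <;> simp_all

theorem codegree_le_maxCodegree (H : BoundedHypergraph V₀ V₁ r₀ r₁) (L₀ : Finset V₀)
    (L₁ : Finset V₁) : H.codegree L₀ L₁ ≤ H.maxCodegree L₀.card L₁.card :=
  le_sup (f := fun L : Finset V₀ × Finset V₁ => H.codegree L.1 L.2) (b := (L₀, L₁)) (by simp)

end BoundedHypergraph

/-! ### Proof of the container theorem -/

open WeightedHypergraph BoundedHypergraph in
theorem theorem2p1 {V₀ V₁ : Type*} [Fintype V₀] [Fintype V₁] [DecidableEq V₀] [DecidableEq V₁]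
    (r₀ r₁ : ℕ) (hr : ¬ (r₀ = 0 ∧ r₁ = 0)) (R : ℝ) (hR : 0 < R)
    (H : BoundedHypergraph V₀ V₁ r₀ r₁) (hH : H.edges.Nonempty)
    (b m q : ℕ) (hb : 0 < b) (hm : 0 < m) (hq : 0 < q)
    (hbm : b ≤ min m (Fintype.card V₁))
    (hdeg : ∀ ℓ₀ ℓ₁ : ℕ, ℓ₀ ≤ r₀ → ℓ₁ ≤ r₁ → ¬ (ℓ₀ = 0 ∧ ℓ₁ = 0) →
      (H.maxCodegree ℓ₀ ℓ₁ : ℝ) ≤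
        R * ((b : ℝ) ^ (ℓ₀ + ℓ₁ - 1) / ((m : ℝ) ^ ℓ₀ * (Fintype.card V₁ : ℝ) ^ ℓ₁)) *
          (H.edges.card : ℝ) * ((m : ℝ) / (q : ℝ)) ^ (if 0 < ℓ₀ then 1 else 0)) :
    ∃ S : Set (Finset V₀ × Finset V₁),
      (∀ s ∈ S, s.1.card ≤ r₀ * b ∧ s.2.card ≤ r₁ * b) ∧
      ∃ (f : S → Finset V₀ × Finset V₁) (g : H.indepPairs m → S),
        (∀ p : H.indepPairs m,
          (f (g p)).1 ⊆ p.1.1 ∧ p.1.2 ⊆ (f (g p)).2) ∧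
        (∀ s : S,
          containerDelta r₀ r₁ R * (q : ℝ) ≤ ((f s).1.card : ℝ) ∨
            ((f s).2.card : ℝ) ≤ (1 - containerDelta r₀ r₁ R) * (Fintype.card V₁ : ℝ)) ∧
        (∀ p : H.indepPairs m,
          (g p).1.1 ⊆ p.1.1ᶜ ∧ (g p).1.2 ⊆ p.1.2 ∧
            (0 < (g p).1.1.card →
              containerDelta r₀ r₁ R * (q : ℝ) ≤ ((f (g p)).1.card : ℝ))) := by
  obtain ⟨hbm, hbV⟩ := le_min_iff.1 hbm
  obtain ⟨s₀, s₁, hs₀, hs₁, hne, hpop⟩ := H.exists_popular_type hH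
  have hb' : (0 : ℝ) < b := by exact_mod_cast hb
  have hm' : (0 : ℝ) < m := by exact_mod_cast hm
  have hV' : (0 : ℝ) < Fintype.card V₁ := by exact_mod_cast hb.trans_le hbV
  have he : (0 : ℝ) < H.edges.card := by exact_mod_cast hH.card_pos
  set F := H.edgesOfType s₀ s₁ with hF
  have hFH : F ⊆ H.edges := Finset.filter_subset _ _
  set δ := containerDelta r₀ r₁ R with hδ
  have hδ0 : 0 ≤ δ := by
    rw [hδ, containerDelta]
    positivity
  -- Dividing by `b` in `M = R * e(H) / b` produces the exponent `ℓ₀ + ℓ₁ - 1` of the hypothesis.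
  obtain ⟨t, ht⟩ := exists_tree hb hm hq hbm hbV hδ0 s₀ s₁ (weight F)
    (R * H.edges.card / b) (fun e => by unfold weight; split_ifs <;> simp) (by positivity)
    (fun e he => (Finset.mem_filter.1 (weight_ne_zero.1 he)).2)
    (by rw [total_weight]; exact_mod_cast hne.card_pos)
    (by
      intro T hT
      by_cases hle : T.toLeft.card ≤ r₀ ∧ T.toRight.card ≤ r₁
      · have hT0 : ¬ (T.toLeft.card = 0 ∧ T.toRight.card = 0) := by
          have := hT.card_pos
          rw [← Finset.card_toLeft_add_card_toRight] at this
          omega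
        have h1 : deg (weight F) T ≤ H.maxCodegree T.toLeft.card T.toRight.card := by
          rw [deg_weight]
          exact_mod_cast (Finset.card_le_card (Finset.filter_subset_filter _ hFH)).trans
            (H.codegree_le_maxCodegree T.toLeft T.toRight)
        refine (h1.trans (hdeg _ _ hle.1 hle.2 hT0)).trans_eq ?_
        obtain ⟨k, hk⟩ : ∃ k, T.toLeft.card + T.toRight.card = k + 1 :=
          Nat.exists_eq_succ_of_ne_zero (by omega)
        have hbk : (b : ℝ) ^ T.toLeft.card * (b : ℝ) ^ T.toRight.card = b ^ k * b := by
          rw [← pow_add, hk, pow_succ]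
        rw [hk, Nat.add_sub_cancel, scale, div_pow (b : ℝ), div_pow (b : ℝ), div_mul_div_comm (_ ^ _), hbk]
        field_simp
      -- The codegree hypothesis is silent on so large a `T`, but no edge contains it.
      · have h0 : deg (weight F) T = 0 := by
          rw [deg_weight, Nat.cast_eq_zero, Finset.card_eq_zero, Finset.filter_eq_empty_iff]
          rintro e heF ⟨h0, h1⟩
          have := H.card_le e (hFH heF)
          exact hle ⟨(Finset.card_le_card h0).trans this.1, (Finset.card_le_card h1).trans this.2⟩
        rw [h0]
        exact mul_nonneg (by positivity) (scale_nonneg b m q T))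
    (fun _ => by
      rw [total_weight, hδ, containerDelta, div_mul_cancel₀ _ hb'.ne']
      calc _ = (H.edges.card : ℝ) * 2 ^ ((s₀ + s₁) * (s₀ + s₁ + 1)) /
            2 ^ ((r₀ + r₁ + 1) * (r₀ + r₁)) := by field_simp
        _ ≤ _ := by
          rw [div_le_iff₀ (by positivity)]
          exact hpop.trans_eq (by ring))
  let K : H.indepPairs m → Finset (V₀ ⊕ V₁) := fun p => (p.1.1ᶜ).disjSum p.1.2
  have hK : ∀ p, IsContainerPair δ b q s₀ s₁ (t.picked (K p)) (t.rejected (K p)) := by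
    rintro ⟨⟨I, J⟩, hind, hcard⟩
    refine ht _ (by simpa [K] using hcard) fun e he heK => ?_
    have := Finset.subset_disjSum.1 heK
    exact hind _ (hFH (weight_ne_zero.1 he)) this
  let fp : H.indepPairs m → Finset V₀ × Finset V₁ := fun p =>
    ((t.picked (K p)).toLeft, (t.picked (K p)).toRight)
  let f : Finset V₀ × Finset V₁ → Finset V₀ × Finset V₁ := fun s =>
    ((t.rejected (s.1.disjSum s.2)).toLeft, ((t.rejected (s.1.disjSum s.2)).toRight)ᶜ)
  have hf : ∀ p, f (fp p) = ((t.rejected (K p)).toLeft, ((t.rejected (K p)).toRight)ᶜ) := by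
    intro p
    -- The tree run on the fingerprint follows the branch of `K p`, so `f` recovers the rejected
    -- vertices.
    have := (t.eq_of_picked_subset (le_refl (t.picked (K p))) (t.picked_subset (K p))).2
    simp only [f, fp, Finset.toLeft_disjSum_toRight, this]
  refine ⟨Set.range fp, ?_, fun s => f s.1, fun p => ⟨fp p, p, rfl⟩, ?_, ?_, ?_⟩
  · rintro _ ⟨p, rfl⟩
    obtain ⟨h0, h1, -⟩ := hK p
    exact ⟨h0.trans (Nat.mul_le_mul_right b hs₀), h1.trans (Nat.mul_le_mul_right b hs₁)⟩
  · intro p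
    have hdis := t.disjoint_rejected (K p)
    simp only [hf]
    refine ⟨fun v hv => ?_, fun v hv => ?_⟩
    · by_contra hvI
      exact Finset.disjoint_left.1 hdis (Finset.mem_toLeft.1 hv) (by simpa [K] using hvI)
    · rw [Finset.mem_compl]
      exact fun hvR =>
        Finset.disjoint_left.1 hdis (Finset.mem_toRight.1 hvR) (by simpa [K] using hv)
  · rintro ⟨_, p, rfl⟩
    simp only [hf]
    refine (hK p).2.2.imp id fun h => ?_
    rw [Finset.card_compl, Nat.cast_sub (Finset.card_le_univ _)]
    linarith [h.2]
  · intro p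
    simp only [hf]
    obtain ⟨h0, h1⟩ := Finset.subset_disjSum.1 (t.picked_subset (K p))
    refine ⟨h0, h1, fun hpos => (hK p).2.2.resolve_right fun h => ?_⟩
    simp [fp, h.1] at hpos
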